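/- Let $K\ge 3$, let $X_1,\dots,X_K$ be Polish spaces with their Borel $\sigma$-algebras, let $\mu_k$ be a Borel probability measure on $X_k$ for $k=1,\dots,K$, and let $c:X_1\times\cdots\times X_K\to\mathbb R$ be bounded and continuous. Let $\Pi(\mu_1,\dots,\mu_K)$ be the set of probability measures on $X_1\times\cdots\times X_K$ whose $k$-th marginal is $\mu_k$ for every $k$, and put $$I(\pi)=\int c\,d\pi,\qquad \mathsf{MOT}_c(\mu_1,\dots,\mu_K)=\inf_{\pi\in\Pi(\mu_1,\dots,\mu_K)}I(\pi),\qquad J(f)=\sum_{k=1}^K\int_{X_k}f_k\,d\mu_k .$$ Let $\mathcal F_c$ be the set of families $f=(f_1,\dots,f_K)$ of Borel functions $f_k:X_k\to\mathbb R$ with $f_k\in L^1(\mu_k)$ and $\sum_{k=1}^K f_k(x_k)\le c(x_1,\dots,x_K)$ for all $(x_1,\dots,x_K)$. For a family $f=(f_1,\dots,f_K)$ of functions $f_l:X_l\to\mathbb R$, its $c$-conjugate in the $k$-th variable is $$f_k^c(x_k)=\inf_{(x_l)_{l\ne k}}\Big\{c(x_1,\dots,x_K)-\sum_{l\ne k}f_l(x_l)\Big\}\in[-\infty,+\infty).$$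 Let $c\text{-conj}(X_k)$ be the set of functions $h:X_k\to\mathbb R$ with $h=f_k^c$ for some family $f$ of real-valued functions, and let $\mathcal S_c$ be the set of families $f$ of real-valued functions with $f_k=f_k^c$ for every $k$. Then there is a family $g=(g_1,\dots,g_K)\in\mathcal F_c$ that maximizes $J$ over $\mathcal F_c$ and whose components are $c$-conjugate: $g_k\in c\text{-conj}(X_k)$ for every $k$, and indeed $g\in\mathcal S_c$. The infimum of $I$ over $\Pi(\mu_1,\dots,\mu_K)$ is attained, and $$\mathsf{MOT}_c(\mu_1,\dots,\mu_K)=\min_{\pi\in\Pi(\mu_1,\dots,\mu_K)}I(\pi)=\max_{f\in\mathcal F_c}J(f)=\max_{\substack{f\in\mathcal F_c\\ f_k\in c\text{-conj}(X_k)\ \forall k}}J(f)=\max_{f\in\mathcal S_c}J(f)=J(g),$$ where all the maxima are attained at $g$. -/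

import Mathlib

open MeasureTheory

noncomputable section

namespace MOT

variable {K : ℕ} {X : Fin K → Type*}

/-- The set `Π(μ₁, …, μ_K)` of multimarginal couplings: probability measures on the product
space whose `k`-th marginal is `μ k` for every `k`. -/
def couplings [∀ k, MeasurableSpace (X k)] (μ : ∀ k, Measure (X k)) :
    Set (Measure (∀ k, X k)) :=
  {π | IsProbabilityMeasure π ∧ ∀ k, π.map (fun x => x k) = μ k}

/-- The transport cost `I(π) = ∫ c dπ`. -/
def primalCost [∀ k, MeasurableSpace (X k)] (c : (∀ k, X k) → ℝ)
    (π : Measure (∀ k, X k)) : ℝ :=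
  ∫ x, c x ∂π

/-- The value of the multimarginal optimal transport problem: the infimum of `I` over all
couplings. -/
def motValue [∀ k, MeasurableSpace (X k)] (c : (∀ k, X k) → ℝ)
    (μ : ∀ k, Measure (X k)) : ℝ :=
  sInf (primalCost c '' couplings μ)

/-- The dual functional `J(f) = ∑ₖ ∫ fₖ dμₖ`. -/
def dualValue [∀ k, MeasurableSpace (X k)] (μ : ∀ k, Measure (X k))
    (f : ∀ k, X k → ℝ) : ℝ :=
  ∑ k, ∫ x, f k x ∂(μ k)

/-- The class of dual admissible families: every `fₖ` is a real-valued measurable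
`μₖ`-integrable function and `∑ₖ fₖ(xₖ) ≤ c(x₁, …, x_K)` at every point. -/
def admissible [∀ k, MeasurableSpace (X k)] (c : (∀ k, X k) → ℝ)
    (μ : ∀ k, Measure (X k)) : Set (∀ k, X k → ℝ) :=
  {f | (∀ k, Measurable (f k) ∧ Integrable (f k) (μ k)) ∧ ∀ x, ∑ k, f k (x k) ≤ c x}

/-- The `c`-conjugate of the family `f` in the `k`-th variable, evaluated at `a`: the infimum of
`c(x) - ∑_{l ≠ k} f_l(x_l)` over the coordinates other than the `k`-th, the `k`-th coordinate
being fixed to `a`. The infimum is taken in the extended reals, so it is `⊥` when the expression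
is unbounded below. -/
def cConjugate (c : (∀ k, X k) → ℝ) (f : ∀ k, X k → ℝ) (k : Fin K) (a : X k) : EReal :=
  ⨅ (x : ∀ l, X l) (_ : x k = a), ((c x - ∑ l ∈ Finset.univ.erase k, f l (x l) : ℝ) : EReal)

/-- The set `c-conj(X_k)` of real-valued functions on `X k` that are the `c`-conjugate in the
`k`-th variable of some family of real-valued functions (whose `k`-th member plays no role). -/
def cConj (c : (∀ k, X k) → ℝ) (k : Fin K) : Set (X k → ℝ) :=
  {h | ∃ f : ∀ l, X l → ℝ, ∀ a, (h a : EReal) = cConjugate c f k a}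

/-- The families of real-valued functions each member of which is the `c`-conjugate of
the other members of the same family. -/
def conjugateFamilies (c : (∀ k, X k) → ℝ) : Set (∀ k, X k → ℝ) :=
  {f | ∀ k a, (f k a : EReal) = cConjugate c f k a}

end MOT

end

/-! Dual attainment: replacing one member at a time by its conjugate raises any admissible family to
a conjugate one (`exists_conjugate_ge`). As |c| ≤ C, conjugate functions oscillate by at most 2C, so
constants of sum zero bring all members into [-4C, 4C] without changing J (`exists_shift_abs_le`).
Near-maximizers may thus be taken uniformly bounded; their classes form nested bounded closed convex
subsets of ⨁ L²(μₖ), which have a common point. Conjugating it once more gives g.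

No duality gap: the dual supremum is a superlinear function of the cost. Hahn-Banach gives a linear
L above it with equality at c (`exists_positive_functional`); L is positive and has marginals μₖ.
Riesz on a compactification represents L by a measure, the marginals keep its mass on the original
space, and the resulting coupling costs at most L(c) (`exists_coupling_integral_le`). Weak duality
closes the circle. -/

noncomputable section

namespace MOT

/-! ### Conjugate families: construction, oscillation, semicontinuity -/

section

variable {K : ℕ} {X : Fin K → Type*}

theorem cConjugate_le (c : (∀ k, X k) → ℝ) (f : ∀ k, X k → ℝ) {k : Fin K} {a : X k}
    {x : ∀ l, X l} (hx : x k = a) :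
    cConjugate c f k a ≤ ((c x - ∑ l ∈ Finset.univ.erase k, f l (x l) : ℝ) : EReal) :=
  iInf₂_le x hx

theorem le_cConjugate {c : (∀ k, X k) → ℝ} {f : ∀ k, X k → ℝ}
    (hf : ∀ x, ∑ k, f k (x k) ≤ c x) (k : Fin K) (a : X k) :
    (f k a : EReal) ≤ cConjugate c f k a := by
  refine le_iInf₂ fun x hx => EReal.coe_le_coe_iff.2 ?_
  have h := hf x
  rw [← Finset.add_sum_erase _ _ (Finset.mem_univ k), hx] at h
  linarith

theorem cConjugate_anti (c : (∀ k, X k) → ℝ) {f g : ∀ k, X k → ℝ} (hfg : ∀ k a, f k a ≤ g k a)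
    (k : Fin K) (a : X k) : cConjugate c g k a ≤ cConjugate c f k a := by
  refine iInf₂_mono fun x _ => EReal.coe_le_coe_iff.2 ?_
  gcongr
  exact hfg _ _

theorem cConjugate_lt_top [∀ k, Nonempty (X k)] (c : (∀ k, X k) → ℝ) (f : ∀ k, X k → ℝ)
    (k : Fin K) (a : X k) : cConjugate c f k a < ⊤ :=
  (cConjugate_le c f (x := Function.update (fun l => Classical.arbitrary (X l)) k a)
    (by simp)).trans_lt (EReal.coe_lt_top _)

/-- Members are conjugated one by one. Each replacement keeps the constraint and raises the family,
and this does not spoil the members already treated. -/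
theorem exists_conjugate_ge [∀ k, Nonempty (X k)] {c : (∀ k, X k) → ℝ} {f : ∀ k, X k → ℝ}
    (hf : ∀ x, ∑ k, f k (x k) ≤ c x) :
    ∃ g ∈ conjugateFamilies c, ∀ k a, f k a ≤ g k a := by
  suffices h : ∀ s : Finset (Fin K), ∃ g : ∀ k, X k → ℝ, (∀ x, ∑ k, g k (x k) ≤ c x) ∧
      (∀ k a, f k a ≤ g k a) ∧ ∀ k ∈ s, ∀ a, (g k a : EReal) = cConjugate c g k a by
    obtain ⟨g, -, hfg, hg⟩ := h Finset.univ
    exact ⟨g, fun k a => hg k (Finset.mem_univ k) a, hfg⟩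
  intro s
  induction s using Finset.induction_on with
  | empty => exact ⟨f, hf, fun _ _ => le_rfl, by simp⟩
  | insert i s _ ih =>
    obtain ⟨g, hg, hfg, hs⟩ := ih
    have hcoe : ∀ a, ((cConjugate c g i a).toReal : EReal) = cConjugate c g i a := fun a =>
      EReal.coe_toReal (cConjugate_lt_top c g i a).ne
        (((EReal.bot_lt_coe _).trans_le (le_cConjugate hg i a)).ne')
    set g' : ∀ k, X k → ℝ := Function.update g i fun a => (cConjugate c g i a).toReal with hg'
    have hi : ∀ a, g' i a = (cConjugate c g i a).toReal := fun a => by simp [hg']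
    have hne : ∀ k, k ≠ i → g' k = g k := fun k hk => by simp [hg', hk]
    have hle : ∀ k a, g k a ≤ g' k a := by
      intro k a
      by_cases hk : k = i
      · subst hk
        rw [hi, ← EReal.coe_le_coe_iff, hcoe]
        exact le_cConjugate hg k a
      · rw [hne k hk]
    have hsum : ∀ x : ∀ k, X k, ∑ l ∈ Finset.univ.erase i, g' l (x l)
        = ∑ l ∈ Finset.univ.erase i, g l (x l) := fun x =>
      Finset.sum_congr rfl fun l hl => by rw [hne l (Finset.ne_of_mem_erase hl)]
    have hadm : ∀ x, ∑ k, g' k (x k) ≤ c x := by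
      intro x
      rw [← Finset.add_sum_erase _ _ (Finset.mem_univ i), hsum, hi]
      have h := cConjugate_le c g (k := i) (x := x) rfl
      rw [← hcoe, EReal.coe_le_coe_iff] at h
      linarith
    refine ⟨g', hadm, fun k a => (hfg k a).trans (hle k a), fun k hk a => ?_⟩
    by_cases hki : k = i
    · subst hki
      rw [hi, hcoe]
      simp only [cConjugate, hsum]
    · have hks : k ∈ s := (Finset.mem_insert.1 hk).resolve_left hki
      refine le_antisymm (le_cConjugate hadm k a) ?_
      rw [hne k hki, hs k hks a]
      exact cConjugate_anti c hle k a

theorem sum_le_of_mem_conjugateFamilies {c : (∀ k, X k) → ℝ} (hK : 0 < K) {g : ∀ k, X k → ℝ}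
    (hg : g ∈ conjugateFamilies c) (x : ∀ k, X k) : ∑ k, g k (x k) ≤ c x := by
  have h := cConjugate_le c g (k := ⟨0, hK⟩) (x := x) rfl
  rw [← hg, EReal.coe_le_coe_iff] at h
  rw [← Finset.add_sum_erase _ _ (Finset.mem_univ (⟨0, hK⟩ : Fin K))]
  linarith

theorem lt_iff_of_mem_conjugateFamilies {c : (∀ k, X k) → ℝ} {g : ∀ k, X k → ℝ}
    (hg : g ∈ conjugateFamilies c) (k : Fin K) (a : X k) (t : ℝ) :
    g k a < t ↔ ∃ x : ∀ l, X l, x k = a ∧ c x - ∑ l ∈ Finset.univ.erase k, g l (x l) < t := by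
  rw [← EReal.coe_lt_coe_iff, hg k a, cConjugate]
  simp only [iInf_lt_iff, EReal.coe_lt_coe_iff, exists_prop]

theorem sum_erase_update (g : ∀ k, X k → ℝ) (k : Fin K) (x : ∀ l, X l) (a : X k) :
    ∑ l ∈ Finset.univ.erase k, g l (Function.update x k a l)
      = ∑ l ∈ Finset.univ.erase k, g l (x l) :=
  Finset.sum_congr rfl fun l hl => by rw [Function.update_of_ne (Finset.ne_of_mem_erase hl)]

/-- Moving the `k`-th coordinate of a near-minimizer for `b` to `a` affects only the cost, by at
most 2C. -/
theorem sub_le_of_mem_conjugateFamilies {c : (∀ k, X k) → ℝ} {C : ℝ} (hb : ∀ x, |c x| ≤ C)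
    {g : ∀ k, X k → ℝ} (hg : g ∈ conjugateFamilies c) (k : Fin K) (a b : X k) :
    g k a - g k b ≤ 2 * C := by
  by_contra! h
  obtain ⟨x, -, hx⟩ := (lt_iff_of_mem_conjugateFamilies hg k b (g k a - 2 * C)).1 (by linarith)
  have h2 : ¬ g k a < g k a := lt_irrefl _
  rw [lt_iff_of_mem_conjugateFamilies hg] at h2
  refine h2 ⟨Function.update x k a, by simp, ?_⟩
  rw [sum_erase_update]
  have h3 := abs_le.1 (hb x)
  have h4 := abs_le.1 (hb (Function.update x k a))
  linarith

/-- An infimum of continuous functions of the `k`-th coordinate. This is the source of Borel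
measurability for conjugates. -/
theorem upperSemicontinuous_of_mem_conjugateFamilies [∀ k, TopologicalSpace (X k)]
    {c : (∀ k, X k) → ℝ} (hc : Continuous c) {g : ∀ k, X k → ℝ} (hg : g ∈ conjugateFamilies c)
    (k : Fin K) : UpperSemicontinuous (g k) := by
  intro a t hat
  obtain ⟨x, rfl, hx⟩ := (lt_iff_of_mem_conjugateFamilies hg k a t).1 hat
  have hcont : Continuous fun b : X k => c (Function.update x k b)
      - ∑ l ∈ Finset.univ.erase k, g l (x l) :=
    (hc.comp (continuous_const.update k continuous_id)).sub continuous_const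
  filter_upwards [hcont.continuousAt.eventually_lt (g := fun _ => t) continuousAt_const
    (x₀ := x k) (by simpa using hx)] with b hb
  exact (lt_iff_of_mem_conjugateFamilies hg k b t).2
    ⟨Function.update x k b, by simp, by rwa [sum_erase_update]⟩

theorem exists_abs_le_of_mem_conjugateFamilies [∀ k, Nonempty (X k)] {c : (∀ k, X k) → ℝ} {C : ℝ}
    (hb : ∀ x, |c x| ≤ C) {g : ∀ k, X k → ℝ} (hg : g ∈ conjugateFamilies c) (k : Fin K) :
    ∃ M, ∀ a, |g k a| ≤ M := by
  let b : X k := Classical.arbitrary _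
  refine ⟨|g k b| + 2 * C, fun a => abs_le.2 ?_⟩
  have h1 := sub_le_of_mem_conjugateFamilies hb hg k a b
  have h2 := sub_le_of_mem_conjugateFamilies hb hg k b a
  constructor <;> cases abs_cases (g k b) <;> linarith

/-- A conjugate family can be shifted by constants of sum zero so as to be bounded by `4 * C`. -/
theorem exists_shift_abs_le [∀ k, Nonempty (X k)] {c : (∀ k, X k) → ℝ} {C : ℝ} (hK : 0 < K)
    (hb : ∀ x, |c x| ≤ C) {g : ∀ k, X k → ℝ} (hg : g ∈ conjugateFamilies c) :
    ∃ t : Fin K → ℝ, ∑ k, t k = 0 ∧ ∀ k a, |g k a + t k| ≤ 4 * C := by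
  let x₀ : ∀ k, X k := fun k => Classical.arbitrary _
  set s : ℝ := ∑ k, g k (x₀ k) with hs
  have hKR : (0 : ℝ) < K := by exact_mod_cast hK
  have hC : 0 ≤ C := (abs_nonneg _).trans (hb x₀)
  have hK1 : (1 : ℝ) ≤ K := by exact_mod_cast hK
  have hs1 : s ≤ C := (sum_le_of_mem_conjugateFamilies hK hg x₀).trans (abs_le.1 (hb x₀)).2
  -- Otherwise a near-minimizer `x` for `x₀ i`, with the other K - 1 terms oscillating by at most 2C
  -- each, would have c(x) < -2C.
  have hs2 : -(2 * C * K) ≤ s := by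
    by_contra! h
    let i : Fin K := ⟨0, hK⟩
    have hsi : s = g i (x₀ i) + ∑ l ∈ Finset.univ.erase i, g l (x₀ l) :=
      (Finset.add_sum_erase _ _ (Finset.mem_univ i)).symm
    obtain ⟨x, -, hx⟩ := (lt_iff_of_mem_conjugateFamilies hg i (x₀ i)
      (-(2 * C * K) - ∑ l ∈ Finset.univ.erase i, g l (x₀ l))).1 (by linarith)
    have h1 : ∑ l ∈ Finset.univ.erase i, g l (x l)
        ≤ ∑ l ∈ Finset.univ.erase i, (g l (x₀ l) + 2 * C) := by
      gcongr with l
      linarith [sub_le_of_mem_conjugateFamilies hb hg l (x l) (x₀ l)]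
    rw [Finset.sum_add_distrib, Finset.sum_const, Finset.card_erase_of_mem (Finset.mem_univ i),
      Finset.card_univ, Fintype.card_fin, nsmul_eq_mul, Nat.cast_sub hK, Nat.cast_one] at h1
    have h2 := (abs_le.1 (hb x)).1
    nlinarith
  have h1 : s / K ≤ 2 * C := by
    rw [div_le_iff₀ hKR]; nlinarith
  have h2 : -(2 * C) ≤ s / K := by
    rw [le_div_iff₀ hKR]; linarith
  -- Every shifted member takes the value s / K at `x₀ k`; 4C is 2C for |s / K| plus 2C of
  -- oscillation.
  refine ⟨fun k => s / K - g k (x₀ k), ?_, fun k a => abs_le.2 ?_⟩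
  · rw [Finset.sum_sub_distrib, Finset.sum_const, Finset.card_univ, Fintype.card_fin,
      nsmul_eq_mul, ← hs]
    field_simp
    ring
  · have h3 := sub_le_of_mem_conjugateFamilies hb hg k a (x₀ k)
    have h4 := sub_le_of_mem_conjugateFamilies hb hg k (x₀ k) a
    constructor <;> linarith

end

/-! ### Existence of a dual maximizer, by convexity in L² -/

section

open Filter Topology

/-- A decreasing sequence of nonempty closed convex subsets of a Hilbert space that are contained
in a common ball has a common point. -/
theorem nonempty_iInter_of_closed_convex {H : Type*} [NormedAddCommGroup H]
    [InnerProductSpace ℝ H] [CompleteSpace H] {S : ℕ → Set H} (hne : ∀ n, (S n).Nonempty)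
    (hcl : ∀ n, IsClosed (S n)) (hcv : ∀ n, Convex ℝ (S n)) (hanti : Antitone S) {R : ℝ}
    (hR : ∀ x ∈ S 0, ‖x‖ ≤ R) : (⋂ n, S n).Nonempty := by
  -- `v n` is the point of least norm in `S n`. The midpoint of `v n` and `v m` is no shorter than
  -- `v n`, so the parallelogram law makes the sequence Cauchy.
  choose v hv hmin using fun n =>
    exists_norm_eq_iInf_of_complete_convex (hne n) (hcl n).isComplete (hcv n) 0
  have hle : ∀ n, ∀ x ∈ S n, ‖v n‖ ≤ ‖x‖ := by
    intro n x hx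
    have h : ⨅ w : S n, ‖(0 : H) - w‖ ≤ ‖(0 : H) - x‖ :=
      ciInf_le ⟨0, by rintro _ ⟨w, rfl⟩; positivity⟩ (⟨x, hx⟩ : S n)
    rw [← hmin n] at h
    simpa using h
  have hmono : Monotone fun n => ‖v n‖ := fun n m hnm => hle n _ (hanti hnm (hv m))
  have hbdd : BddAbove (Set.range fun n => ‖v n‖) :=
    ⟨R, by rintro _ ⟨n, rfl⟩; exact hR _ (hanti (Nat.zero_le n) (hv n))⟩
  set r := ⨆ n, ‖v n‖
  have hr : Tendsto (fun n => ‖v n‖) atTop (𝓝 r) := tendsto_atTop_ciSup hmono hbdd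
  have hcauchy : CauchySeq v := by
    refine cauchySeq_of_le_tendsto_0' (fun n => √(2 * (r ^ 2 - ‖v n‖ ^ 2))) (fun n m hnm => ?_) ?_
    · refine Real.le_sqrt_of_sq_le ?_
      have hmid : (1 / 2 : ℝ) • v n + (1 / 2 : ℝ) • v m ∈ S n :=
        hcv n (hv n) (hanti hnm (hv m)) (by norm_num) (by norm_num) (by norm_num)
      have h1 := hle n _ hmid
      rw [← smul_add, norm_smul, Real.norm_of_nonneg (by norm_num)] at h1
      have h2 := parallelogram_law_with_norm ℝ (v n) (v m)
      have h3 : ‖v m‖ ≤ r := le_ciSup hbdd m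
      rw [dist_eq_norm]
      nlinarith [norm_nonneg (v n), norm_nonneg (v m)]
    · have h : Tendsto (fun n => √(2 * (r ^ 2 - ‖v n‖ ^ 2))) atTop (𝓝 √(2 * (r ^ 2 - r ^ 2))) :=
        ((tendsto_const_nhds.sub (hr.pow 2)).const_mul 2).sqrt
      simpa using h
  obtain ⟨w, hw⟩ := cauchySeq_tendsto_of_complete hcauchy
  refine ⟨w, Set.mem_iInter.2 fun n => (hcl n).mem_of_tendsto hw ?_⟩
  filter_upwards [eventually_ge_atTop n] with m hm using hanti hm (hv m)

variable {K : ℕ} {X : Fin K → Type*} [∀ k, MeasurableSpace (X k)]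

/-- The families of measurable functions with values in `[m, M]` that satisfy the pointwise dual
constraint and have dual value at least `t`. -/
def boundedAdmissible (c : (∀ k, X k) → ℝ) (μ : ∀ k, Measure (X k)) (m M t : ℝ) :
    Set (∀ k, X k → ℝ) :=
  {f | (∀ k, Measurable (f k)) ∧ (∀ k a, f k a ∈ Set.Icc m M) ∧ (∀ x, ∑ k, f k (x k) ≤ c x) ∧
    t ≤ dualValue μ f}

theorem integrable_of_mem_Icc {α : Type*} [MeasurableSpace α] {μ : Measure α} [IsFiniteMeasure μ]
    {f : α → ℝ} {m M : ℝ} (hf : Measurable f) (h : ∀ a, f a ∈ Set.Icc m M) : Integrable f μ :=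
  Integrable.of_mem_Icc m M hf.aemeasurable (ae_of_all _ h)

theorem convex_boundedAdmissible (c : (∀ k, X k) → ℝ) (μ : ∀ k, Measure (X k))
    [∀ k, IsFiniteMeasure (μ k)] (m M t : ℝ) : Convex ℝ (boundedAdmissible c μ m M t) := by
  rintro f ⟨hf1, hf2, hf3, hf4⟩ g ⟨hg1, hg2, hg3, hg4⟩ a b ha hb hab
  refine ⟨fun k => ((hf1 k).const_mul a).add ((hg1 k).const_mul b),
    fun k x => convex_Icc m M (hf2 k x) (hg2 k x) ha hb hab, fun x => ?_, ?_⟩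
  · have h : ∑ k, (a • f + b • g) k (x k) = a * ∑ k, f k (x k) + b * ∑ k, g k (x k) := by
      simp [Finset.sum_add_distrib, Finset.mul_sum]
    rw [h]
    calc _ ≤ a * c x + b * c x := by gcongr <;> [exact hf3 x; exact hg3 x]
      _ = c x := by rw [← add_mul, hab, one_mul]
  · have h : dualValue μ (a • f + b • g) = a * dualValue μ f + b * dualValue μ g := by
      simp only [dualValue, Finset.mul_sum, ← Finset.sum_add_distrib]
      refine Finset.sum_congr rfl fun k _ => ?_
      rw [← integral_const_mul, ← integral_const_mul, ← integral_add
        ((integrable_of_mem_Icc (hf1 k) (hf2 k)).const_mul a)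
        ((integrable_of_mem_Icc (hg1 k) (hg2 k)).const_mul b)]
      rfl
    rw [h]
    calc t = a * t + b * t := by rw [← add_mul, hab, one_mul]
      _ ≤ _ := by gcongr

theorem exists_subseq_tendsto_ae {μ : ∀ k, Measure (X k)} [∀ k, IsFiniteMeasure (μ k)]
    {F : ℕ → ∀ k, X k → ℝ} {G : ∀ k, X k → ℝ}
    (h : ∀ k, TendstoInMeasure (μ k) (fun n => F n k) atTop (G k)) :
    ∃ φ : ℕ → ℕ, StrictMono φ ∧
      ∀ k, ∀ᵐ a ∂μ k, Tendsto (fun n => F (φ n) k a) atTop (𝓝 (G k a)) := by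
  suffices h' : ∀ s : Finset (Fin K), ∃ φ : ℕ → ℕ, StrictMono φ ∧
      ∀ k ∈ s, ∀ᵐ a ∂μ k, Tendsto (fun n => F (φ n) k a) atTop (𝓝 (G k a)) by
    obtain ⟨φ, hφ, hs⟩ := h' Finset.univ
    exact ⟨φ, hφ, fun k => hs k (Finset.mem_univ k)⟩
  intro s
  induction s using Finset.induction_on with
  | empty => exact ⟨id, strictMono_id, by simp⟩
  | insert i s _ ih =>
    obtain ⟨φ, hφ, hs⟩ := ih
    have hi : TendstoInMeasure (μ i) (fun n => F (φ n) i) atTop (G i) :=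
      (h i).comp hφ.tendsto_atTop
    obtain ⟨ψ, hψ, hae⟩ := hi.exists_seq_tendsto_ae
    refine ⟨φ ∘ ψ, hφ.comp hψ, fun k hk => ?_⟩
    rcases Finset.mem_insert.1 hk with rfl | hk
    · exact hae
    · filter_upwards [hs k hk] with a ha using ha.comp hψ.tendsto_atTop

/-- The constraint has to survive at every point although convergence is only almost everywhere.
Where convergence fails the functions are reset to `m`, which by `hc` is so low that one such
coordinate enforces the constraint alone. -/
theorem exists_mem_boundedAdmissible_of_tendsto_ae {c : (∀ k, X k) → ℝ} {μ : ∀ k, Measure (X k)}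
    [∀ k, IsFiniteMeasure (μ k)] {m M t : ℝ} (hm : m ≤ M) (hc : ∀ x, m + (K - 1) * M ≤ c x)
    {f : ℕ → ∀ k, X k → ℝ} (hf : ∀ n, f n ∈ boundedAdmissible c μ m M t) {G : ∀ k, X k → ℝ}
    (hG : ∀ k, ∀ᵐ a ∂μ k, Tendsto (fun n => f n k a) atTop (𝓝 (G k a))) :
    ∃ g ∈ boundedAdmissible c μ m M t, ∀ k, G k =ᵐ[μ k] g k := by
  classical
  let T : ∀ k, Set (X k) := fun k => {a | ∃ l, Tendsto (fun n => f n k a) atTop (𝓝 l)}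
  have hT : ∀ k, MeasurableSet (T k) := fun k =>
    measurableSet_exists_tendsto fun n => (hf n).1 k
  let f' : ℕ → ∀ k, X k → ℝ := fun n k a => if a ∈ T k then f n k a else m
  have hlim : ∀ k a, ∃ l, Tendsto (fun n => f' n k a) atTop (𝓝 l) := by
    intro k a
    by_cases h : a ∈ T k
    · obtain ⟨l, hl⟩ := id h
      exact ⟨l, by simpa [f', h] using hl⟩
    · exact ⟨m, by simp [f', h]⟩
  choose g hg using hlim
  have hmeas : ∀ n k, Measurable (f' n k) := fun n k =>
    Measurable.ite (hT k) ((hf n).1 k) measurable_const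
  have hIcc : ∀ n k a, f' n k a ∈ Set.Icc m M := by
    intro n k a
    by_cases h : a ∈ T k
    · simpa [f', h] using (hf n).2.1 k a
    · simp [f', h, hm]
  have hadm : ∀ n x, ∑ k, f' n k (x k) ≤ c x := by
    intro n x
    by_cases h : ∀ k, x k ∈ T k
    · simpa [f', h] using (hf n).2.2.1 x
    · push Not at h
      obtain ⟨i, hi⟩ := h
      refine le_trans ?_ (hc x)
      rw [← Finset.add_sum_erase _ _ (Finset.mem_univ i)]
      have h1 : ∑ l ∈ Finset.univ.erase i, f' n l (x l) ≤ ∑ l ∈ Finset.univ.erase i, M :=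
        Finset.sum_le_sum fun l _ => (hIcc n l (x l)).2
      rw [Finset.sum_const, Finset.card_erase_of_mem (Finset.mem_univ i), Finset.card_univ,
        Fintype.card_fin, nsmul_eq_mul, Nat.cast_sub i.pos, Nat.cast_one] at h1
      have h2 : f' n i (x i) = m := by simp [f', hi]
      linarith
  have hmemT : ∀ k, ∀ᵐ a ∂μ k, a ∈ T k := fun k => by
    filter_upwards [hG k] with a ha using ⟨_, ha⟩
  have hdual : ∀ n, t ≤ dualValue μ (f' n) := by
    intro n
    refine (hf n).2.2.2.trans_eq (Finset.sum_congr rfl fun k _ => integral_congr_ae ?_)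
    filter_upwards [hmemT k] with a ha
    simp [f', ha]
  refine ⟨g, ⟨fun k => measurable_of_tendsto_metrizable (fun n => hmeas n k)
    (tendsto_pi_nhds.2 (hg k)), fun k a => isClosed_Icc.mem_of_tendsto (hg k a)
    (Eventually.of_forall fun n => hIcc n k a), fun x => ?_, ?_⟩, fun k => ?_⟩
  · exact le_of_tendsto' (tendsto_finsetSum _ fun k _ => hg k (x k)) fun n => hadm n x
  · refine ge_of_tendsto' (tendsto_finsetSum _ fun k _ =>
      tendsto_integral_of_dominated_convergence (fun _ => max |m| |M|)
        (fun n => (hmeas n k).aestronglyMeasurable) (integrable_const _)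
        (fun n => ae_of_all _ fun a => ?_) (ae_of_all _ (hg k))) hdual
    exact abs_le_max_abs_abs (hIcc n k a).1 (hIcc n k a).2
  · filter_upwards [hG k, hmemT k] with a ha haT
    exact tendsto_nhds_unique ha (by simpa [f', haT] using hg k a)

/-- The classes in `⨁ₖ L²(μₖ)` of the members of `boundedAdmissible`. -/
def boundedAdmissibleL2 (c : (∀ k, X k) → ℝ) (μ : ∀ k, Measure (X k)) (m M t : ℝ) :
    Set (PiLp 2 fun k => Lp ℝ 2 (μ k)) :=
  {F | ∃ f ∈ boundedAdmissible c μ m M t, ∀ k, F k =ᵐ[μ k] f k}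

theorem convex_boundedAdmissibleL2 (c : (∀ k, X k) → ℝ) (μ : ∀ k, Measure (X k))
    [∀ k, IsFiniteMeasure (μ k)] (m M t : ℝ) : Convex ℝ (boundedAdmissibleL2 c μ m M t) := by
  rintro F ⟨f, hf, hFf⟩ G ⟨g, hg, hGg⟩ a b ha hb hab
  refine ⟨a • f + b • g, convex_boundedAdmissible c μ m M t hf hg ha hb hab, fun k => ?_⟩
  have h : (a • F + b • G) k = a • F k + b • G k := rfl
  rw [h]
  filter_upwards [Lp.coeFn_add (a • F k) (b • G k), Lp.coeFn_smul a (F k), Lp.coeFn_smul b (G k),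
    hFf k, hGg k] with x h1 h2 h3 h4 h5
  rw [h1, Pi.add_apply, h2, h3, Pi.smul_apply, Pi.smul_apply, h4, h5]
  rfl

theorem isClosed_boundedAdmissibleL2 {c : (∀ k, X k) → ℝ} {μ : ∀ k, Measure (X k)}
    [∀ k, IsFiniteMeasure (μ k)] {m M : ℝ} (hm : m ≤ M) (hc : ∀ x, m + (K - 1) * M ≤ c x) (t : ℝ) :
    IsClosed (boundedAdmissibleL2 c μ m M t) := by
  refine IsSeqClosed.isClosed fun F G hF hFG => ?_
  choose f hf hFf using hF
  obtain ⟨φ, -, hφ⟩ := exists_subseq_tendsto_ae (μ := μ) (F := fun n k => F n k)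
    (G := fun k => G k) fun k => tendstoInMeasure_of_tendsto_Lp
      (((PiLp.continuous_apply 2 _ k).tendsto G).comp hFG)
  obtain ⟨g, hg, hGg⟩ := exists_mem_boundedAdmissible_of_tendsto_ae hm hc
    (f := fun n => f (φ n)) (fun n => hf (φ n)) (G := fun k => G k) fun k => by
      filter_upwards [hφ k, ae_all_iff.2 fun n => hFf (φ n) k] with a h1 h2
      simpa only [h2] using h1
  exact ⟨g, hg, hGg⟩

theorem norm_le_of_mem_boundedAdmissibleL2 {c : (∀ k, X k) → ℝ} {μ : ∀ k, Measure (X k)}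
    [∀ k, IsProbabilityMeasure (μ k)] {m M t : ℝ} {F : PiLp 2 fun k => Lp ℝ 2 (μ k)}
    (hF : F ∈ boundedAdmissibleL2 c μ m M t) : ‖F‖ ≤ √(∑ _k : Fin K, (max |m| |M|) ^ 2) := by
  obtain ⟨f, hf, hFf⟩ := hF
  rw [PiLp.norm_eq_of_L2]
  gcongr with k
  have h := Lp.norm_le_of_ae_bound (f := F k) (C := max |m| |M|) (by positivity) (by
    filter_upwards [hFf k] with a ha
    rw [ha]
    exact abs_le_max_abs_abs (hf.2.1 k a).1 (hf.2.1 k a).2)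
  refine h.trans_eq ?_
  have h1 : measureUnivNNReal (μ k) = 1 := by simp [measureUnivNNReal]
  simp [h1]

theorem nonempty_boundedAdmissibleL2 {c : (∀ k, X k) → ℝ} {μ : ∀ k, Measure (X k)}
    [∀ k, IsFiniteMeasure (μ k)] {m M t : ℝ} (h : (boundedAdmissible c μ m M t).Nonempty) :
    (boundedAdmissibleL2 c μ m M t).Nonempty := by
  obtain ⟨f, hf⟩ := h
  have hL : ∀ k, MemLp (f k) 2 (μ k) := fun k =>
    MemLp.of_bound (hf.1 k).aestronglyMeasurable (max |m| |M|) (ae_of_all _ fun a =>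
      abs_le_max_abs_abs (hf.2.1 k a).1 (hf.2.1 k a).2)
  exact ⟨WithLp.toLp 2 fun k => (hL k).toLp, f, hf, fun k => (hL k).coeFn_toLp⟩

/-- If dual values arbitrarily close to `D` are reached by families with values in `[m, M]`, then
`D` is reached as well. -/
theorem nonempty_boundedAdmissible_of_forall_lt {c : (∀ k, X k) → ℝ} {μ : ∀ k, Measure (X k)}
    [∀ k, IsProbabilityMeasure (μ k)] {m M D : ℝ} (hm : m ≤ M)
    (hc : ∀ x, m + (K - 1) * M ≤ c x)
    (h : ∀ t < D, (boundedAdmissible c μ m M t).Nonempty) :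
    (boundedAdmissible c μ m M D).Nonempty := by
  obtain ⟨u, hu, hlt, hlim⟩ := exists_seq_strictMono_tendsto D
  obtain ⟨F, hF⟩ := nonempty_iInter_of_closed_convex
    (S := fun n => boundedAdmissibleL2 c μ m M (u n))
    (fun n => nonempty_boundedAdmissibleL2 (h _ (hlt n)))
    (fun n => isClosed_boundedAdmissibleL2 hm hc _) (fun n => convex_boundedAdmissibleL2 _ _ _ _ _)
    (fun i j hij G hG => by
      obtain ⟨f, hf, hGf⟩ := hG
      exact ⟨f, ⟨hf.1, hf.2.1, hf.2.2.1, (hu.monotone hij).trans hf.2.2.2⟩, hGf⟩)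
    (fun G hG => norm_le_of_mem_boundedAdmissibleL2 hG)
  rw [Set.mem_iInter] at hF
  obtain ⟨f, hf, hFf⟩ := hF 0
  -- The representatives of `F` obtained at different levels agree almost everywhere, so `f` reaches
  -- every level `u n`.
  refine ⟨f, hf.1, hf.2.1, hf.2.2.1, le_of_tendsto' hlim fun n => ?_⟩
  obtain ⟨g, hg, hFg⟩ := hF n
  refine hg.2.2.2.trans_eq (Finset.sum_congr rfl fun k _ => integral_congr_ae ?_)
  exact (hFg k).symm.trans (hFf k)

theorem dualValue_mono {μ : ∀ k, Measure (X k)} {f g : ∀ k, X k → ℝ}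
    (hf : ∀ k, Integrable (f k) (μ k)) (hg : ∀ k, Integrable (g k) (μ k))
    (hfg : ∀ k a, f k a ≤ g k a) : dualValue μ f ≤ dualValue μ g :=
  Finset.sum_le_sum fun k _ => integral_mono (hf k) (hg k) (hfg k)

variable [∀ k, TopologicalSpace (X k)] [∀ k, BorelSpace (X k)]

theorem mem_admissible_of_mem_conjugateFamilies {c : (∀ k, X k) → ℝ} {μ : ∀ k, Measure (X k)}
    [∀ k, IsProbabilityMeasure (μ k)] {C : ℝ} (hK : 0 < K) (hc : Continuous c)
    (hb : ∀ x, |c x| ≤ C) {g : ∀ k, X k → ℝ} (hg : g ∈ conjugateFamilies c) :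
    g ∈ admissible c μ := by
  have : ∀ k, Nonempty (X k) := fun k => nonempty_of_isProbabilityMeasure (μ k)
  refine ⟨fun k => ?_, sum_le_of_mem_conjugateFamilies hK hg⟩
  have hmeas : Measurable (g k) :=
    (upperSemicontinuous_of_mem_conjugateFamilies hc hg k).measurable
  obtain ⟨M, hM⟩ := exists_abs_le_of_mem_conjugateFamilies hb hg k
  exact ⟨hmeas, integrable_of_mem_Icc hmeas fun a => abs_le.1 (hM a)⟩

theorem exists_conjugate_dualValue_ge {c : (∀ k, X k) → ℝ} {μ : ∀ k, Measure (X k)}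
    [∀ k, IsProbabilityMeasure (μ k)] {C : ℝ} (hK : 0 < K) (hc : Continuous c)
    (hb : ∀ x, |c x| ≤ C) {f : ∀ k, X k → ℝ} (hf : f ∈ admissible c μ) :
    ∃ g ∈ conjugateFamilies c, dualValue μ f ≤ dualValue μ g := by
  have : ∀ k, Nonempty (X k) := fun k => nonempty_of_isProbabilityMeasure (μ k)
  obtain ⟨g, hg, hfg⟩ := exists_conjugate_ge hf.2
  have hga := mem_admissible_of_mem_conjugateFamilies (μ := μ) hK hc hb hg
  exact ⟨g, hg, dualValue_mono (fun k => (hf.1 k).2) (fun k => (hga.1 k).2) hfg⟩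

theorem boundedAdmissible_nonempty_of_mem_admissible {c : (∀ k, X k) → ℝ}
    {μ : ∀ k, Measure (X k)} [∀ k, IsProbabilityMeasure (μ k)] {C : ℝ} (hK : 0 < K)
    (hc : Continuous c) (hb : ∀ x, |c x| ≤ C) {m : ℝ} (hm : m ≤ -(4 * C))
    {f : ∀ k, X k → ℝ} (hf : f ∈ admissible c μ) :
    (boundedAdmissible c μ m (4 * C) (dualValue μ f)).Nonempty := by
  have : ∀ k, Nonempty (X k) := fun k => nonempty_of_isProbabilityMeasure (μ k)
  obtain ⟨g, hg, hfg⟩ := exists_conjugate_dualValue_ge hK hc hb hf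
  have hga := mem_admissible_of_mem_conjugateFamilies (μ := μ) hK hc hb hg
  obtain ⟨s, hs, hbd⟩ := exists_shift_abs_le hK hb hg
  refine ⟨fun k a => g k a + s k, fun k => (hga.1 k).1.add_const _,
    fun k a => ⟨hm.trans (abs_le.1 (hbd k a)).1, (abs_le.1 (hbd k a)).2⟩, fun x => ?_, ?_⟩
  · rw [Finset.sum_add_distrib, hs, add_zero]
    exact hga.2 x
  · refine hfg.trans_eq ?_
    have h : ∀ k, ∫ a, g k a + s k ∂μ k = ∫ a, g k a ∂μ k + s k := fun k => by
      rw [integral_add (hga.1 k).2 (integrable_const _)]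
      simp
    simp only [dualValue, h, Finset.sum_add_distrib, hs, add_zero]

/-- The dual problem has a solution which is a conjugate family. -/
theorem exists_conjugate_maximizer {c : (∀ k, X k) → ℝ} (μ : ∀ k, Measure (X k))
    [∀ k, IsProbabilityMeasure (μ k)] {C : ℝ} (hK : 0 < K) (hc : Continuous c)
    (hb : ∀ x, |c x| ≤ C) :
    ∃ g ∈ conjugateFamilies c, ∀ f ∈ admissible c μ, dualValue μ f ≤ dualValue μ g := by
  have hne : ∀ k, Nonempty (X k) := fun k => nonempty_of_isProbabilityMeasure (μ k)
  have hKR : (1 : ℝ) ≤ K := by exact_mod_cast hK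
  have hC : 0 ≤ C := (abs_nonneg _).trans (hb fun k => Classical.arbitrary _)
  -- Low enough that one value `m` and K - 1 values of at most 4C sum to at most -5C ≤ c.
  set m : ℝ := -(4 * C) - C - (K - 1) * (4 * C)
  have hm : m ≤ -(4 * C) := by
    have : 0 ≤ (K - 1 : ℝ) * (4 * C) := by apply mul_nonneg <;> linarith
    linarith
  have hcm : ∀ x, m + (K - 1) * (4 * C) ≤ c x := fun x => by
    have := (abs_le.1 (hb x)).1
    linarith
  have hbdd : BddAbove (dualValue μ '' admissible c μ) := by
    refine ⟨∑ _k : Fin K, 4 * C, ?_⟩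
    rintro _ ⟨f, hf, rfl⟩
    obtain ⟨f', hf'⟩ := boundedAdmissible_nonempty_of_mem_admissible hK hc hb hm hf
    refine hf'.2.2.2.trans (Finset.sum_le_sum fun k _ => ?_)
    refine (integral_mono (integrable_of_mem_Icc (hf'.1 k) (hf'.2.1 k))
      (integrable_const (4 * C)) fun a => (hf'.2.1 k a).2).trans_eq ?_
    simp
  have hadm : (dualValue μ '' admissible c μ).Nonempty := by
    refine ⟨_, fun k _ => -C / K, ⟨fun k => ⟨measurable_const, integrable_const _⟩, fun x => ?_⟩,
      rfl⟩
    rw [Finset.sum_const, Finset.card_univ, Fintype.card_fin, nsmul_eq_mul,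
      mul_div_cancel₀ _ (by positivity)]
    exact (abs_le.1 (hb x)).1
  obtain ⟨f, hf⟩ := nonempty_boundedAdmissible_of_forall_lt (μ := μ)
    (D := sSup (dualValue μ '' admissible c μ)) (by linarith : m ≤ 4 * C) hcm fun t ht => by
      obtain ⟨_, ⟨f, hf, rfl⟩, htf⟩ := exists_lt_of_lt_csSup hadm ht
      obtain ⟨f', hf'⟩ := boundedAdmissible_nonempty_of_mem_admissible hK hc hb hm hf
      exact ⟨f', hf'.1, hf'.2.1, hf'.2.2.1, htf.le.trans hf'.2.2.2⟩
  -- The limit `f` is merely admissible; conjugating again loses nothing in J.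
  obtain ⟨g, hg, hfg⟩ := exists_conjugate_dualValue_ge (μ := μ) hK hc hb
    (f := f) ⟨fun k => ⟨hf.1 k, integrable_of_mem_Icc (hf.1 k) (hf.2.1 k)⟩, hf.2.2.1⟩
  exact ⟨g, hg, fun f' hf' =>
    ((le_csSup hbdd (Set.mem_image_of_mem _ hf')).trans hf.2.2.2).trans hfg⟩

end

/-! ### Absence of a duality gap: Hahn-Banach and Riesz -/

section

open Filter Topology BoundedContinuousFunction unitInterval

/-- Hahn-Banach: a superlinear functional has a linear functional above it that touches it at a
given point. -/
theorem exists_linearMap_ge_superlinear {E : Type*} [AddCommGroup E] [Module ℝ E] (q : E → ℝ)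
    (hsmul : ∀ t : ℝ, 0 < t → ∀ x, q (t • x) = t * q x) (hadd : ∀ x y, q x + q y ≤ q (x + y))
    (x₀ : E) : ∃ L : E →ₗ[ℝ] ℝ, L x₀ = q x₀ ∧ ∀ x, q x ≤ L x := by
  have hq0 : q 0 = 0 := by
    have := hsmul 2 (by norm_num) 0
    rw [smul_zero] at this
    linarith
  have hker : ∀ t : ℝ, t • x₀ = 0 → RingHom.id ℝ t • (-q x₀) = 0 := by
    intro t ht
    rcases smul_eq_zero.1 ht with rfl | rfl <;> simp [hq0]
  obtain ⟨L, hL, hLq⟩ := exists_extension_of_le_sublinear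
    (LinearPMap.mkSpanSingleton' x₀ (-q x₀) hker) (fun x => -q x)
    (fun t ht x => by simp [hsmul t ht]) (fun x y => by linarith [hadd x y]) (by
      rintro ⟨y, hy⟩
      obtain ⟨t, rfl⟩ := Submodule.mem_span_singleton.1
        (by rwa [LinearPMap.domain_mkSpanSingleton] at hy)
      rw [LinearPMap.mkSpanSingleton'_apply]
      simp only [RingHom.id_apply, smul_eq_mul]
      rcases lt_trichotomy t 0 with ht | rfl | ht
      -- For negative t, superadditivity gives q(t x₀) + q(-t x₀) ≤ q(0) = 0.
      · have h1 := hadd (t • x₀) ((-t) • x₀)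
        rw [← add_smul, add_neg_cancel, zero_smul, hq0, hsmul (-t) (by linarith)] at h1
        linarith
      · simp [hq0]
      · rw [hsmul t ht]
        linarith)
  refine ⟨-L, ?_, fun x => ?_⟩
  · have h := hL ⟨x₀, by
      rw [LinearPMap.domain_mkSpanSingleton]; exact Submodule.mem_span_singleton_self x₀⟩
    rw [LinearPMap.mkSpanSingleton'_apply_self] at h
    simp only [LinearMap.neg_apply, h, neg_neg]
  · have := hLq x
    simp only [LinearMap.neg_apply]
    linarith

/-- Riesz representation of positive functionals on `C(Z, ℝ)` with `Z` compact. -/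
theorem exists_measure_of_positive {Z : Type*} [TopologicalSpace Z] [CompactSpace Z] [T2Space Z]
    [MeasurableSpace Z] [BorelSpace Z] (Λ : C(Z, ℝ) →ₗ[ℝ] ℝ)
    (hΛ : ∀ φ : C(Z, ℝ), (∀ z, 0 ≤ φ z) → 0 ≤ Λ φ) :
    ∃ ν : Measure Z, IsFiniteMeasure ν ∧ ∀ φ : C(Z, ℝ), ∫ z, φ z ∂ν = Λ φ := by
  let Λ' : CompactlySupportedContinuousMap Z ℝ →ₚ[ℝ] ℝ := PositiveLinearMap.mk₀
    { toFun := fun φ => Λ φ.toContinuousMap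
      map_add' := fun φ ψ => Λ.map_add φ.toContinuousMap ψ.toContinuousMap
      map_smul' := fun t φ => Λ.map_smul t φ.toContinuousMap } fun φ hφ => hΛ _ hφ
  refine ⟨RealRMK.rieszMeasure Λ', inferInstance, fun φ => ?_⟩
  exact RealRMK.integral_rieszMeasure Λ' (CompactlySupportedContinuousMap.continuousMapEquiv φ)

/-- A bounded continuous function on a subspace of a compact metrizable space is the pointwise limit
from below of a uniformly bounded sequence of continuous functions on the whole space. -/
theorem exists_continuousMap_approx_below {Y Z : Type*} [TopologicalSpace Y] [Nonempty Y]
    [TopologicalSpace Z] [TopologicalSpace.MetrizableSpace Z] {e : Y → Z} (he : IsEmbedding e)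
    {c : Y → ℝ} (hc : Continuous c) {C : ℝ} (hb : ∀ y, |c y| ≤ C) :
    ∃ φ : ℕ → C(Z, ℝ), (∀ n y, φ n (e y) ≤ c y) ∧ (∀ n y, -C ≤ φ n (e y)) ∧
      ∀ y, Tendsto (fun n => φ n (e y)) atTop (𝓝 (c y)) := by
  let := TopologicalSpace.metrizableSpaceMetric Z
  -- Lipschitz regularization: `ψ n` is n-Lipschitz on all of `Z` and at most c on the image of `e`.
  let ψ : ℕ → Z → ℝ := fun n z => ⨅ y, (c y + n * dist z (e y))
  have hlow : ∀ (n : ℕ) z y, -C ≤ c y + n * dist z (e y) := fun n z y => by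
    have h1 := (abs_le.1 (hb y)).1
    have h2 : 0 ≤ n * dist z (e y) := by positivity
    linarith
  have hle : ∀ (n : ℕ) z y, ψ n z ≤ c y + n * dist z (e y) := fun n z y =>
    ciInf_le ⟨-C, by rintro _ ⟨y, rfl⟩; exact hlow n z y⟩ y
  have hlip : ∀ n : ℕ, LipschitzWith n (ψ n) := fun n =>
    LipschitzWith.of_le_add_mul _ fun z z' => by
      rw [← sub_le_iff_le_add]
      refine le_ciInf fun y => ?_
      have h1 := hle n z y
      have h2 := mul_le_mul_of_nonneg_left (dist_triangle z z' (e y)) (Nat.cast_nonneg (α := ℝ) n)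
      rw [mul_add] at h2
      simp only [NNReal.coe_natCast]
      linarith
  have hψc : ∀ n y, ψ n (e y) ≤ c y := fun n y => by simpa using hle n (e y) y
  refine ⟨fun n => ⟨ψ n, (hlip n).continuous⟩, hψc,
    fun n y => le_ciInf fun y' => hlow n (e y) y', fun y => ?_⟩
  rw [Metric.tendsto_atTop]
  intro ε hε
  have hnear : ∀ᶠ y' in 𝓝 y, c y - ε / 2 < c y' :=
    hc.continuousAt.eventually (lt_mem_nhds (by linarith))
  rw [he.nhds_eq_comap, eventually_comap, Metric.eventually_nhds_iff] at hnear
  obtain ⟨δ, hδ, hnear⟩ := hnear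
  -- From `N` on, points at distance at least δ pay a penalty above 2C, so they cannot push the
  -- infimum below c(y).
  obtain ⟨N, hN⟩ := exists_nat_gt (2 * C / δ)
  refine ⟨N, fun n hn => ?_⟩
  rw [div_lt_iff₀ hδ] at hN
  have hnN : (N : ℝ) ≤ n := by exact_mod_cast hn
  have h1 : c y - ε / 2 ≤ ψ n (e y) := by
    refine le_ciInf fun y' => ?_
    by_cases hd : dist (e y') (e y) < δ
    · have h2 := hnear hd y' rfl
      have h3 : 0 ≤ n * dist (e y) (e y') := by positivity
      linarith
    · rw [not_lt, dist_comm] at hd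
      have h2 : (N : ℝ) * δ ≤ n * dist (e y) (e y') := by gcongr
      have h3 := abs_le.1 (hb y)
      have h4 := abs_le.1 (hb y')
      linarith
  have h2 := hψc n y
  change dist (ψ n (e y)) (c y) < ε
  rw [Real.dist_eq, abs_lt]
  constructor <;> linarith

variable {K : ℕ} {X : Fin K → Type*} [∀ k, MeasurableSpace (X k)]

theorem integrable_comp_eval_of_mem_couplings {μ : ∀ k, Measure (X k)} {π : Measure (∀ k, X k)}
    (hπ : π ∈ couplings μ) {k : Fin K} {h : X k → ℝ} (hi : Integrable h (μ k)) :
    Integrable (fun x => h (x k)) π := by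
  rw [← hπ.2 k] at hi
  exact hi.comp_measurable (measurable_pi_apply k)

theorem integral_comp_eval_of_mem_couplings {μ : ∀ k, Measure (X k)} {π : Measure (∀ k, X k)}
    (hπ : π ∈ couplings μ) {k : Fin K} {h : X k → ℝ} (hi : Integrable h (μ k)) :
    ∫ x, h (x k) ∂π = ∫ a, h a ∂μ k := by
  rw [← hπ.2 k] at hi ⊢
  exact (integral_map (measurable_pi_apply k).aemeasurable hi.aestronglyMeasurable).symm

theorem dualValue_le_primalCost {μ : ∀ k, Measure (X k)} {π : Measure (∀ k, X k)}
    (hπ : π ∈ couplings μ) {c : (∀ k, X k) → ℝ} (hc : Integrable c π) {f : ∀ k, X k → ℝ}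
    (hf : f ∈ admissible c μ) : dualValue μ f ≤ primalCost c π := by
  have h : dualValue μ f = ∫ x, ∑ k, f k (x k) ∂π := by
    rw [integral_finsetSum _ fun k _ => integrable_comp_eval_of_mem_couplings hπ (hf.1 k).2]
    exact Finset.sum_congr rfl fun k _ =>
      (integral_comp_eval_of_mem_couplings hπ (hf.1 k).2).symm
  rw [h]
  exact integral_mono (integrable_finsetSum _ fun k _ =>
    integrable_comp_eval_of_mem_couplings hπ (hf.1 k).2) hc hf.2

theorem pi_mem_couplings (μ : ∀ k, Measure (X k)) [∀ k, IsProbabilityMeasure (μ k)] :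
    Measure.pi μ ∈ couplings μ :=
  ⟨inferInstance, fun k => (measurePreserving_eval μ k).map_eq⟩

theorem add_mem_admissible {μ : ∀ k, Measure (X k)} {u v : (∀ k, X k) → ℝ} {f g : ∀ k, X k → ℝ}
    (hf : f ∈ admissible u μ) (hg : g ∈ admissible v μ) : f + g ∈ admissible (u + v) μ := by
  refine ⟨fun k => ⟨(hf.1 k).1.add (hg.1 k).1, (hf.1 k).2.add (hg.1 k).2⟩, fun x => ?_⟩
  simp only [Pi.add_apply, Finset.sum_add_distrib]
  exact add_le_add (hf.2 x) (hg.2 x)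

theorem dualValue_add {μ : ∀ k, Measure (X k)} {u v : (∀ k, X k) → ℝ} {f g : ∀ k, X k → ℝ}
    (hf : f ∈ admissible u μ) (hg : g ∈ admissible v μ) :
    dualValue μ (f + g) = dualValue μ f + dualValue μ g := by
  simp only [dualValue, ← Finset.sum_add_distrib]
  exact Finset.sum_congr rfl fun k _ => integral_add (hf.1 k).2 (hg.1 k).2

theorem smul_mem_admissible {μ : ∀ k, Measure (X k)} {u : (∀ k, X k) → ℝ} {f : ∀ k, X k → ℝ}
    (hf : f ∈ admissible u μ) {t : ℝ} (ht : 0 ≤ t) : t • f ∈ admissible (t • u) μ := by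
  refine ⟨fun k => ⟨(hf.1 k).1.const_mul t, (hf.1 k).2.const_mul t⟩, fun x => ?_⟩
  simp only [Pi.smul_apply, smul_eq_mul, ← Finset.mul_sum]
  exact mul_le_mul_of_nonneg_left (hf.2 x) ht

theorem dualValue_smul (μ : ∀ k, Measure (X k)) (f : ∀ k, X k → ℝ) (t : ℝ) :
    dualValue μ (t • f) = t * dualValue μ f := by
  simp only [dualValue, Finset.mul_sum]
  exact Finset.sum_congr rfl fun k _ => integral_const_mul t _

/-- The supremum of the dual functional. -/
def dualSup (μ : ∀ k, Measure (X k)) (u : (∀ k, X k) → ℝ) : ℝ :=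
  sSup (dualValue μ '' admissible u μ)

/-- One-member families test the dual problem on costs depending on one coordinate; they force the
marginals of the Hahn-Banach functional. -/
theorem single_mem_admissible {μ : ∀ k, Measure (X k)} {k : Fin K} {h : X k → ℝ}
    (hm : Measurable h) (hi : Integrable h (μ k)) :
    (Pi.single k h : ∀ l, X l → ℝ) ∈ admissible (fun x => h (x k)) μ := by
  refine ⟨fun l => ?_, fun x => le_of_eq ?_⟩
  · by_cases hl : l = k
    · subst hl
      simpa using ⟨hm, hi⟩
    · simp only [Pi.single_eq_of_ne hl]
      exact ⟨measurable_zero, integrable_zero _ _ _⟩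
  · rw [Finset.sum_eq_single k (fun l _ hl => by simp [Pi.single_eq_of_ne hl]) (by simp)]
    simp

theorem dualValue_single (μ : ∀ k, Measure (X k)) (k : Fin K) (h : X k → ℝ) :
    dualValue μ (Pi.single k h : ∀ l, X l → ℝ) = ∫ a, h a ∂μ k := by
  rw [dualValue, Finset.sum_eq_single k (fun l _ hl => by simp [Pi.single_eq_of_ne hl]) (by simp)]
  simp

theorem nonempty_admissible [∀ k, TopologicalSpace (X k)] (μ : ∀ k, Measure (X k))
    [∀ k, IsProbabilityMeasure (μ k)] (hK : 0 < K) (u : (∀ k, X k) →ᵇ ℝ) : (admissible u μ).Nonempty := by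
  refine ⟨Pi.single (⟨0, hK⟩ : Fin K) fun _ => -‖u‖,
    (single_mem_admissible measurable_const (integrable_const _)).1, fun x => ?_⟩
  exact ((single_mem_admissible (μ := μ) measurable_const (integrable_const _)).2 x).trans
    (abs_le.1 (u.norm_coe_le_norm x)).1

section Polish

variable [∀ k, TopologicalSpace (X k)] [∀ k, PolishSpace (X k)] [∀ k, BorelSpace (X k)]
  (μ : ∀ k, Measure (X k)) [∀ k, IsProbabilityMeasure (μ k)]

theorem bddAbove_dualValue (u : (∀ k, X k) →ᵇ ℝ) :
    BddAbove (dualValue μ '' admissible u μ) :=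
  ⟨primalCost u (Measure.pi μ), by
    rintro _ ⟨f, hf, rfl⟩
    exact dualValue_le_primalCost (pi_mem_couplings μ) (u.integrable _) hf⟩

theorem le_dualSup {u : (∀ k, X k) →ᵇ ℝ} {f : ∀ k, X k → ℝ} (hf : f ∈ admissible u μ) :
    dualValue μ f ≤ dualSup μ u :=
  le_csSup (bddAbove_dualValue μ u) (Set.mem_image_of_mem _ hf)

theorem dualSup_add (hK : 0 < K) (u v : (∀ k, X k) →ᵇ ℝ) :
    dualSup μ u + dualSup μ v ≤ dualSup μ (u + v : (∀ k, X k) →ᵇ ℝ) := by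
  rw [← le_sub_iff_add_le]
  refine csSup_le ((nonempty_admissible μ hK u).image _) ?_
  rintro _ ⟨f, hf, rfl⟩
  rw [le_sub_comm]
  refine csSup_le ((nonempty_admissible μ hK v).image _) ?_
  rintro _ ⟨g, hg, rfl⟩
  rw [le_sub_iff_add_le', ← dualValue_add hf hg]
  exact le_dualSup μ (add_mem_admissible hf hg)

theorem dualSup_smul (hK : 0 < K) {t : ℝ} (ht : 0 < t) (u : (∀ k, X k) →ᵇ ℝ) :
    dualSup μ (t • u : (∀ k, X k) →ᵇ ℝ) = t * dualSup μ u := by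
  have key : ∀ {t : ℝ}, 0 < t → ∀ u : (∀ k, X k) →ᵇ ℝ,
      dualSup μ u ≤ t⁻¹ * dualSup μ (t • u : (∀ k, X k) →ᵇ ℝ) := by
    intro t ht u
    refine csSup_le ((nonempty_admissible μ hK u).image _) ?_
    rintro _ ⟨f, hf, rfl⟩
    rw [le_inv_mul_iff₀ ht, ← dualValue_smul]
    exact le_dualSup μ (smul_mem_admissible hf ht.le)
  refine le_antisymm ?_ ((le_inv_mul_iff₀ ht).1 (key ht u))
  -- The reverse inequality is the same one, for t⁻¹ and the cost t u.
  have h := key (inv_pos.2 ht) (t • u)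
  rwa [inv_inv, inv_smul_smul₀ ht.ne'] at h

/-- A positive functional on bounded continuous functions which has the marginals `μ k` and whose
value at `c` is the supremum of the dual problem. -/
theorem exists_positive_functional (hK : 0 < K) (c : (∀ k, X k) →ᵇ ℝ) :
    ∃ L : ((∀ k, X k) →ᵇ ℝ) →ₗ[ℝ] ℝ, L c = dualSup μ c ∧
      (∀ u : (∀ k, X k) →ᵇ ℝ, (∀ x, 0 ≤ u x) → 0 ≤ L u) ∧
      ∀ k (h : X k →ᵇ ℝ), L (h.compContinuous ⟨fun x => x k, continuous_apply k⟩)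
        = ∫ a, h a ∂μ k := by
  obtain ⟨q, hq⟩ : ∃ q : ((∀ k, X k) →ᵇ ℝ) → ℝ, ∀ u, q u = dualSup μ u := ⟨_, fun _ => rfl⟩
  obtain ⟨L, hLc, hL⟩ := exists_linearMap_ge_superlinear q
    (fun t ht u => by rw [hq, hq, dualSup_smul μ hK ht])
    (fun u v => by rw [hq, hq, hq]; exact dualSup_add μ hK u v) c
  rw [hq] at hLc
  simp only [hq] at hL
  refine ⟨L, hLc, fun u hu => ?_, fun k h => ?_⟩
  -- The zero family is admissible for u ≥ 0, so the dual supremum, and with it L(u), is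
  -- nonnegative.
  · have h0 : (0 : ∀ k, X k → ℝ) ∈ admissible u μ :=
      ⟨fun k => ⟨measurable_zero, integrable_zero _ _ _⟩, fun x => by simpa using hu x⟩
    have h1 := (le_dualSup μ h0).trans (hL u)
    simpa [dualValue] using h1
  · have key : ∀ h : X k →ᵇ ℝ, ∫ a, h a ∂μ k
        ≤ L (h.compContinuous ⟨fun x => x k, continuous_apply k⟩) := fun h => by
      rw [← dualValue_single μ k h]
      exact (le_dualSup μ (u := h.compContinuous ⟨fun x => x k, continuous_apply k⟩)
        (single_mem_admissible h.continuous.measurable (h.integrable _))).trans (hL _)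
    refine le_antisymm ?_ (key h)
    have h1 := key (-h)
    have h2 : (-h).compContinuous ⟨fun x : ∀ k, X k => x k, continuous_apply k⟩
        = -h.compContinuous ⟨fun x => x k, continuous_apply k⟩ := by
      ext x; rfl
    rw [h2, map_neg] at h1
    simp only [coe_neg, Pi.neg_apply, integral_neg] at h1
    linarith

/-- A positive functional on bounded continuous functions with the marginals `μ k` dominates the
integral with respect to some coupling. -/
theorem exists_coupling_integral_le {L : ((∀ k, X k) →ᵇ ℝ) →ₗ[ℝ] ℝ} (hK : 0 < K)
    (hpos : ∀ u : (∀ k, X k) →ᵇ ℝ, (∀ x, 0 ≤ u x) → 0 ≤ L u)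
    (hmarg : ∀ k (h : X k →ᵇ ℝ), L (h.compContinuous ⟨fun x => x k, continuous_apply k⟩)
        = ∫ a, h a ∂μ k) :
    ∃ π ∈ couplings μ, ∀ c : (∀ k, X k) →ᵇ ℝ, ∫ x, c x ∂π ≤ L c := by
  have hne : ∀ k, Nonempty (X k) := fun k => nonempty_of_isProbabilityMeasure (μ k)
  -- Riesz needs a compact space, so each factor is placed in a Hilbert cube.
  have hemb : ∀ k, ∃ F : X k → ℕ → I, IsEmbedding F := fun k =>
    letI := TopologicalSpace.upgradeIsCompletelyMetrizable (X k)
    Metric.PiNatEmbed.exists_embedding_to_hilbert_cube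
  choose ι hι using hemb
  have hιm : ∀ k, MeasurableEmbedding (ι k) := fun k =>
    (hι k).continuous.measurableEmbedding (hι k).injective
  let e : (∀ k, X k) → Fin K → ℕ → I := fun x k => ι k (x k)
  have he : IsEmbedding e := IsEmbedding.piMap hι
  have hem : MeasurableEmbedding e := he.continuous.measurableEmbedding he.injective
  let ec : C(∀ k, X k, Fin K → ℕ → I) := ⟨e, he.continuous⟩
  let Λ : C(Fin K → ℕ → I, ℝ) →ₗ[ℝ] ℝ :=
    { toFun := fun φ => L ((mkOfCompact φ).compContinuous ec)
      map_add' := fun φ ψ => L.map_add ((mkOfCompact φ).compContinuous ec)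
        ((mkOfCompact ψ).compContinuous ec)
      map_smul' := fun t φ => L.map_smul t ((mkOfCompact φ).compContinuous ec) }
  obtain ⟨ν, hνf, hν⟩ := exists_measure_of_positive Λ fun φ hφ => hpos _ fun x => hφ _
  have hνmarg : ∀ k, ν.map (fun z => z k) = (μ k).map (ι k) := by
    intro k
    refine ext_of_forall_integral_eq_of_IsFiniteMeasure fun h => ?_
    rw [integral_map (measurable_pi_apply k).aemeasurable
      h.continuous.measurable.aestronglyMeasurable,
      integral_map (hιm k).measurable.aemeasurable h.continuous.measurable.aestronglyMeasurable]
    exact (hν (h.toContinuousMap.comp ⟨fun z => z k, continuous_apply k⟩)).trans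
      (hmarg k (h.compContinuous ⟨ι k, (hι k).continuous⟩))
  -- No mass escapes to the added points: each marginal of `ν` is carried by the image of its
  -- factor, which is Borel since `X k` is Polish.
  have hrange : ∀ᵐ z ∂ν, z ∈ Set.range e := by
    have h : ∀ k, ∀ᵐ z ∂ν, z k ∈ Set.range (ι k) := fun k => by
      have h1 : ∀ᵐ w ∂ν.map (fun z => z k), w ∈ Set.range (ι k) := by
        rw [hνmarg k]
        exact (ae_map_iff (hιm k).measurable.aemeasurable (hιm k).measurableSet_range).2
          (ae_of_all _ fun a => ⟨a, rfl⟩)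
      exact ae_of_ae_map (measurable_pi_apply k).aemeasurable h1
    filter_upwards [ae_all_iff.2 h] with z hz
    choose x hx using hz
    exact ⟨x, funext hx⟩
  let π := ν.comap e
  have hπmap : π.map e = ν := by
    rw [hem.map_comap, Measure.restrict_eq_self_of_ae_mem hrange]
  have hπmarg : ∀ k, π.map (fun x => x k) = μ k := by
    intro k
    have h : (π.map fun x => x k).map (ι k) = (μ k).map (ι k) := by
      rw [Measure.map_map (hιm k).measurable (measurable_pi_apply k), ← hνmarg k, ← hπmap,
        Measure.map_map (measurable_pi_apply k) hem.measurable]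
      rfl
    rw [← (hιm k).comap_map (π.map fun x => x k), h, (hιm k).comap_map]
  have hπprob : IsProbabilityMeasure π := by
    have h : IsProbabilityMeasure (π.map fun x => x ⟨0, hK⟩) := by
      rw [hπmarg]; infer_instance
    exact Measure.isProbabilityMeasure_of_map (fun x : ∀ k, X k => x ⟨0, hK⟩)
  refine ⟨π, ⟨hπprob, hπmarg⟩, fun c => ?_⟩
  -- c need not extend to the cube, but approximants from below live there; positivity bounds their
  -- integrals by L(c).
  obtain ⟨φ, hle, hlow, hlim⟩ := exists_continuousMap_approx_below he c.continuous
    (fun x => c.norm_coe_le_norm x)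
  have hint : Tendsto (fun n => ∫ x, φ n (e x) ∂π) atTop (𝓝 (∫ x, c x ∂π)) :=
    tendsto_integral_of_dominated_convergence (fun _ => ‖c‖)
      (fun n => ((φ n).continuous.comp he.continuous).measurable.aestronglyMeasurable)
      (integrable_const _) (fun n => ae_of_all _ fun x => abs_le.2
        ⟨hlow n x, (hle n x).trans (abs_le.1 (c.norm_coe_le_norm x)).2⟩)
      (ae_of_all _ hlim)
  refine le_of_tendsto' hint fun n => ?_
  have h1 : ∫ x, φ n (e x) ∂π = L ((mkOfCompact (φ n)).compContinuous ec) := by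
    rw [← hem.integral_map (fun z => φ n z), hπmap]
    exact hν (φ n)
  have h2 := hpos (c - (mkOfCompact (φ n)).compContinuous ec) fun x => sub_nonneg.2 (hle n x)
  rw [map_sub] at h2
  linarith

/-- Some coupling has cost at most the supremum of the dual problem. -/
theorem exists_coupling_primalCost_le_dualSup (hK : 0 < K) (c : (∀ k, X k) →ᵇ ℝ) :
    ∃ π ∈ couplings μ, primalCost c π ≤ dualSup μ c := by
  obtain ⟨L, hLc, hpos, hmarg⟩ := exists_positive_functional μ hK c
  obtain ⟨π, hπ, h⟩ := exists_coupling_integral_le μ hK hpos hmarg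
  exact ⟨π, hπ, (h c).trans_eq hLc⟩

end Polish

end

end MOT

end

/-! ### Assembly: weak duality meets the coupling from Hahn-Banach -/

theorem theorem4p6 {K : ℕ} (hK : 3 ≤ K) {X : Fin K → Type*}
    [∀ k, TopologicalSpace (X k)] [∀ k, PolishSpace (X k)]
    [∀ k, MeasurableSpace (X k)] [∀ k, BorelSpace (X k)]
    (μ : ∀ k, Measure (X k)) [∀ k, IsProbabilityMeasure (μ k)]
    (c : (∀ k, X k) → ℝ) (hc : Continuous c) (hb : ∃ C : ℝ, ∀ x, |c x| ≤ C) :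
    ∃ g : ∀ k, X k → ℝ,
      g ∈ MOT.admissible c μ ∧
      (∀ k, g k ∈ MOT.cConj c k) ∧
      g ∈ MOT.conjugateFamilies c ∧
      IsGreatest (MOT.dualValue μ '' MOT.admissible c μ) (MOT.dualValue μ g) ∧
      IsGreatest
        (MOT.dualValue μ '' {f | f ∈ MOT.admissible c μ ∧ ∀ k, f k ∈ MOT.cConj c k})
        (MOT.dualValue μ g) ∧
      IsGreatest (MOT.dualValue μ '' MOT.conjugateFamilies c) (MOT.dualValue μ g) ∧
      IsLeast (MOT.primalCost c '' MOT.couplings μ) (MOT.dualValue μ g) ∧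
      MOT.motValue c μ = MOT.dualValue μ g := by
  obtain ⟨C, hC⟩ := hb
  have hK0 : 0 < K := by omega
  obtain ⟨g, hg, hmax⟩ := MOT.exists_conjugate_maximizer μ hK0 hc hC
  have hadm : ∀ f ∈ MOT.conjugateFamilies c, f ∈ MOT.admissible c μ := fun f hf =>
    MOT.mem_admissible_of_mem_conjugateFamilies hK0 hc hC hf
  have hconj : ∀ k, g k ∈ MOT.cConj c k := fun k => ⟨g, hg k⟩
  let cb : BoundedContinuousFunction (∀ k, X k) ℝ := .ofNormedAddCommGroup c hc C hC
  have hleast : IsLeast (MOT.primalCost c '' MOT.couplings μ) (MOT.dualValue μ g) := by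
    have hweak : ∀ π ∈ MOT.couplings μ, MOT.dualValue μ g ≤ MOT.primalCost c π := fun π hπ => by
      have := hπ.1
      exact MOT.dualValue_le_primalCost hπ (cb.integrable π) (hadm g hg)
    obtain ⟨π, hπ, hle⟩ := MOT.exists_coupling_primalCost_le_dualSup μ hK0 cb
    have hsup : MOT.dualSup μ cb ≤ MOT.dualValue μ g :=
      csSup_le ⟨_, g, hadm g hg, rfl⟩ (by rintro _ ⟨f, hf, rfl⟩; exact hmax f hf)
    refine ⟨⟨π, hπ, le_antisymm (hle.trans hsup) (hweak π hπ)⟩, ?_⟩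
    rintro _ ⟨π', hπ', rfl⟩
    exact hweak π' hπ'
  refine ⟨g, hadm g hg, hconj, hg, ⟨⟨g, hadm g hg, rfl⟩, ?_⟩, ⟨⟨g, ⟨hadm g hg, hconj⟩, rfl⟩, ?_⟩,
    ⟨⟨g, hg, rfl⟩, ?_⟩, hleast, hleast.csInf_eq⟩
  · rintro _ ⟨f, hf, rfl⟩
    exact hmax f hf
  · rintro _ ⟨f, hf, rfl⟩
    exact hmax f hf.1
  · rintro _ ⟨f, hf, rfl⟩
    exact hmax f (hadm f hf)
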